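/- A smooth dynamical system on $\mathbb{R}^k$ is a smooth ($C^\infty$) flow $\Phi\colon\mathbb{R}\times\mathbb{R}^k\to\mathbb{R}^k$, and an equilibrium of $\Phi$ is a point $x$ with $\Phi^t(x)=x$ for all $t\in\mathbb{R}$. The system is called super-linearizable if, for some integer $m\ge 0$, some real $(k+m)\times(k+m)$ matrix $A$ and some map $p\colon\mathbb{R}^k\to\mathbb{R}^m$, the map $f\colon\mathbb{R}^k\to\mathbb{R}^{k+m}$, $f(x)=(x,p(x))$, is a smooth embedding (a smooth map that is a homeomorphism onto its image and has injective derivative everywhere) satisfying $\exp(tA)\,f(x)=f(\Phi^t(x))$ for all $t\in\mathbb{R}$ and $x\in\mathbb{R}^k$. **Theorem.** For every integer $k>1$ and every integer $\ell\ge 0$ there exists a super-linearizable smooth dynamical system on $\mathbb{R}^k$ that has exactly $\ell$ equilibria, all of which are isolated. -/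

import Mathlib

open Topology
open scoped ContDiff Matrix

noncomputable section

namespace SuperLinear

/-- Euclidean space `ℝ^n`. -/
abbrev Euc (n : ℕ) : Type := EuclideanSpace ℝ (Fin n)

/-- The (complete, two-sided) flow `Φ` on `ℝ^k` is smooth: `(t, x) ↦ Φ t x` is jointly `C^∞`. -/
def IsSmoothFlow {k : ℕ} (Φ : Flow ℝ (Euc k)) : Prop :=
  ContDiff ℝ ∞ (fun q : ℝ × Euc k => Φ q.1 q.2)

/-- An equilibrium of the flow: a point that is fixed for all time. -/
def IsEquilibrium {k : ℕ} (Φ : Flow ℝ (Euc k)) (x : Euc k) : Prop :=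
  ∀ t : ℝ, Φ t x = x

/-- An isolated equilibrium: an equilibrium with a neighbourhood containing no other one. -/
def IsIsolatedEquilibrium {k : ℕ} (Φ : Flow ℝ (Euc k)) (x : Euc k) : Prop :=
  IsEquilibrium Φ x ∧ ∃ U ∈ 𝓝 x, ∀ y ∈ U, IsEquilibrium Φ y → y = x

/-- The linear flow `x ↦ exp(tA) x` on `ℝ^n` generated by the matrix `A`. -/
def linearFlow {n : ℕ} (A : Matrix (Fin n) (Fin n) ℝ) (t : ℝ) (x : Euc n) : Euc n :=
  WithLp.toLp 2 (NormedSpace.exp (t • A) *ᵥ x.ofLp)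

/-- A smooth embedding `ℝ^k → ℝ^n`: a smooth map which is a homeomorphism onto its image and
whose derivative is injective at every point. -/
structure IsSmoothEmb {k n : ℕ} (f : Euc k → Euc n) : Prop where
  smooth : ContDiff ℝ ∞ f
  embedding : IsEmbedding f
  injective_fderiv : ∀ x, Function.Injective (fderiv ℝ f x)

/-- `f` is a linearizing embedding of `Φ` into the linear flow generated by `A`. -/
structure IsLinearizingEmbedding {k n : ℕ} (Φ : Flow ℝ (Euc k))
    (A : Matrix (Fin n) (Fin n) ℝ) (f : Euc k → Euc n) : Prop where
  isSmoothEmb : IsSmoothEmb f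
  equivariant : ∀ (t : ℝ) (x : Euc k), linearFlow A t (f x) = f (Φ t x)

/-- The graph map `x ↦ (x, p x)` from `ℝ^k` to `ℝ^(k+m)`. -/
def graphMap {k m : ℕ} (p : Euc k → Euc m) (x : Euc k) : Euc (k + m) :=
  WithLp.toLp 2 (Fin.append x.ofLp (p x).ofLp)

/-- `Φ` is super-linearizable: it has a linearizing embedding of the form `x ↦ (x, p x)`. -/
def IsSuperLinearizable {k : ℕ} (Φ : Flow ℝ (Euc k)) : Prop :=
  ∃ (m : ℕ) (A : Matrix (Fin (k + m)) (Fin (k + m)) ℝ) (p : Euc k → Euc m),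
    IsLinearizingEmbedding Φ A (graphMap p)

end SuperLinear

end

/-!
The linear field `u' = w`, `w' = u`, `q' = 0` preserves the hyperboloid `w² + q² = 1 + u²`, an
annulus, and lifts to its universal cover, the plane of pairs `(u, s)` with `w = √(1 + u²) cos s`
and `q = √(1 + u²) sin s`. The lift vanishes exactly at the points `(0, π / 2 + j π)`, so the strip
`0 < s < l π`, invariant because `q' = 0`, contains exactly `l` equilibria.

Every function of `q` is a first integral, and on the universal cover so is a smooth staircase `T`
which increases with `s` from `0` to `l` across the strip and is flat where `|q| ≥ 1 / 2`. For an
odd step function `g`, the observables `g(q) u` and `g(q) w`, as well as `T u w` and `T (u² + w²)`,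
evolve linearly. Hence so do `u` and `v = (2 + u²) T - g(q) w + log T - log (l - T)`, for which
`v' = 2 T u w - g(q) u`, and `(u, v)` identifies the strip with the plane: `v` increases with `s`,
because `T` grows where `|q| < 1 / 2` and `-g(q) w` grows elsewhere, and the logarithms, which are
first integrals, make it onto.

Further dimensions are filled by the expanding field `y' = y`, which has a single zero, and a
translation has no equilibria.
-/

noncomputable section

namespace SuperLinear

section InvariantGraph

variable {E F : Type*} [NormedAddCommGroup E] [NormedSpace ℝ E]
  [NormedAddCommGroup F] [NormedSpace ℝ F]

theorem eq_zero_of_hasDerivAt_clm {A : ℝ → E →L[ℝ] E} (hA : Continuous A) {y : ℝ → E}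
    (hy : ∀ t, HasDerivAt y (A t (y t)) t) (h0 : y 0 = 0) : y = 0 := by
  ext t
  obtain ⟨C, hC⟩ := (isCompact_Icc (a := -(|t| + 1)) (b := |t| + 1)).exists_bound_of_continuousOn
    hA.continuousOn
  have lipschitz : ∀ s ∈ Set.Ioo (-(|t| + 1)) (|t| + 1),
      LipschitzOnWith C.toNNReal (A s) Set.univ := fun s hs =>
    ((A s).lipschitz.weaken (NNReal.coe_le_coe.1
      ((hC s (Set.Ioo_subset_Icc_self hs)).trans (Real.le_coe_toNNReal C)))).lipschitzOnWith
  refine ODE_solution_unique_of_mem_Ioo (t₀ := 0) (g := 0) lipschitz ?_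
    (fun s _ => ⟨hy s, trivial⟩)
    (fun s _ => ⟨by simp, trivial⟩) h0 ?_
  · exact ⟨by linarith [abs_nonneg t], by linarith [abs_nonneg t]⟩
  · exact ⟨by linarith [neg_abs_le t], by linarith [le_abs_self t]⟩

section Exp

variable [CompleteSpace E] (L : E →L[ℝ] E)

theorem hasDerivAt_exp_smul_apply (x : E) (t : ℝ) :
    HasDerivAt (fun t : ℝ => NormedSpace.exp (t • L) x) (L (NormedSpace.exp (t • L) x)) t :=
  (ContinuousLinearMap.apply ℝ E x).hasFDerivAt.comp_hasDerivAt t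
    (hasDerivAt_exp_smul_const' (𝕂 := ℝ) L t)

theorem contDiff_exp_smul_apply {n : WithTop ℕ∞} :
    ContDiff ℝ n fun q : ℝ × E => NormedSpace.exp (q.1 • L) q.2 := by
  have contDiff_exp : ContDiff ℝ n (NormedSpace.exp : (E →L[ℝ] E) → E →L[ℝ] E) :=
    contDiff_iff_contDiffAt.2 fun M => (NormedSpace.exp_analytic (𝕂 := ℝ) M).contDiffAt
  exact (contDiff_exp.comp (contDiff_fst.smul contDiff_const)).clm_apply contDiff_snd

theorem exp_add_smul_apply (s t : ℝ) (x : E) :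
    NormedSpace.exp ((s + t) • L) x = NormedSpace.exp (s • L) (NormedSpace.exp (t • L) x) := by
  let := NormedAlgebra.restrictScalars ℚ ℝ (E →L[ℝ] E)
  rw [add_smul, NormedSpace.exp_add_of_commute
    (((Commute.refl L).smul_left s).smul_right t), mul_apply_eq_comp]

theorem exp_smul_apply_eq_self_iff {x : E} :
    (∀ t : ℝ, NormedSpace.exp (t • L) x = x) ↔ L x = 0 := by
  constructor
  · intro h
    have hderiv := hasDerivAt_exp_smul_apply L x 0
    simp only [h] at hderiv
    exact hderiv.unique (hasDerivAt_const 0 x)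
  · intro h t
    have hderiv (t : ℝ) : HasDerivAt (fun t : ℝ => NormedSpace.exp (t • L) x) 0 t := by
      refine ((ContinuousLinearMap.apply ℝ E x).hasFDerivAt.comp_hasDerivAt t
        (hasDerivAt_exp_smul_const (𝕂 := ℝ) L t)).congr_deriv ?_
      simp [h]
    simpa using is_const_of_deriv_eq_zero (fun t => (hderiv t).differentiableAt)
      (fun t => (hderiv t).deriv) t 0

end Exp

/-- The linear vector field `L` on `E × F` is tangent to the graph of `p : E → F` at each of its
points. -/
def IsTangentToGraph (L : E × F →L[ℝ] E × F) (p : E → F) : Prop :=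
  ∀ x, (L (x, p x)).2 = fderiv ℝ p x (L (x, p x)).1

variable {L : E × F →L[ℝ] E × F} {p : E → F}

namespace IsTangentToGraph

theorem apply_eq_zero_iff (hL : IsTangentToGraph L p) {x : E} :
    L (x, p x) = 0 ↔ (L (x, p x)).1 = 0 := by
  refine ⟨fun h => by rw [h, Prod.fst_zero], fun h => Prod.ext h ?_⟩
  rw [hL, h, map_zero, Prod.snd_zero]

theorem mem_graph (hL : IsTangentToGraph L p) (hp : ContDiff ℝ 1 p) {z : ℝ → E × F}
    (hz : ∀ t, HasDerivAt z (L (z t)) t) (h0 : (z 0).2 = p (z 0).1) (t : ℝ) :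
    (z t).2 = p (z t).1 := by
  let A (t : ℝ) : F →L[ℝ] F :=
    (ContinuousLinearMap.snd ℝ E F - (fderiv ℝ p (z t).1).comp (ContinuousLinearMap.fst ℝ E F)).comp
      (L.comp (ContinuousLinearMap.inr ℝ E F))
  have hzc : Continuous z := continuous_iff_continuousAt.2 fun t => (hz t).continuousAt
  have hA : Continuous A := by
    refine (continuous_const.sub (Continuous.clm_comp ?_ continuous_const)).clm_comp
      continuous_const
    exact (hp.continuous_fderiv one_ne_zero).comp hzc.fst
  have hδ (t : ℝ) : HasDerivAt (fun t => (z t).2 - p (z t).1) (A t ((z t).2 - p (z t).1)) t := by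
    have hsplit : z t = ((z t).1, p (z t).1) + (0, (z t).2 - p (z t).1) := by ext <;> simp
    have hderiv := (hz t).hasFDerivAt.snd.hasDerivAt.sub ((hp.differentiable one_ne_zero
      (z t).1).hasFDerivAt.comp_hasDerivAt t (hz t).hasFDerivAt.fst.hasDerivAt)
    refine hderiv.congr_deriv ?_
    conv_lhs => rw [hsplit, map_add]
    simp [A, hL (z t).1]
  exact sub_eq_zero.1 (congrFun (eq_zero_of_hasDerivAt_clm hA hδ (sub_eq_zero.2 h0)) t)

section Flow

variable [CompleteSpace E] [CompleteSpace F]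

theorem exp_smul_apply (hL : IsTangentToGraph L p) (hp : ContDiff ℝ 1 p) (t : ℝ) (x : E) :
    NormedSpace.exp (t • L) (x, p x) =
      ((NormedSpace.exp (t • L) (x, p x)).1, p (NormedSpace.exp (t • L) (x, p x)).1) :=
  Prod.ext rfl (hL.mem_graph hp (fun t => hasDerivAt_exp_smul_apply L _ t) (by simp) t)

/-- The flow on `E` obtained by restricting the linear flow `exp (t • L)` to the invariant graph
of `p` and projecting it to `E`. -/
def flow (hL : IsTangentToGraph L p) (hp : ContDiff ℝ 1 p) : Flow ℝ E where
  toFun t x := (NormedSpace.exp (t • L) (x, p x)).1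
  cont' := ((contDiff_exp_smul_apply L (n := 0)).continuous.comp
    (continuous_fst.prodMk (continuous_snd.prodMk (hp.continuous.comp continuous_snd)))).fst
  map_add' s t x := by rw [exp_add_smul_apply, hL.exp_smul_apply hp t]
  map_zero' x := by simp

theorem contDiff_flow (hL : IsTangentToGraph L p) (hp : ContDiff ℝ 1 p) {n : WithTop ℕ∞}
    (hpn : ContDiff ℝ n p) : ContDiff ℝ n fun q : ℝ × E => hL.flow hp q.1 q.2 :=
  ((contDiff_exp_smul_apply L).comp
    (contDiff_fst.prodMk (contDiff_snd.prodMk (hpn.comp contDiff_snd)))).fst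

theorem exp_smul_apply_eq_flow (hL : IsTangentToGraph L p) (hp : ContDiff ℝ 1 p) (t : ℝ) (x : E) :
    NormedSpace.exp (t • L) (x, p x) = (hL.flow hp t x, p (hL.flow hp t x)) :=
  hL.exp_smul_apply hp t x

theorem flow_eq_self_iff (hL : IsTangentToGraph L p) (hp : ContDiff ℝ 1 p) {x : E} :
    (∀ t, hL.flow hp t x = x) ↔ (L (x, p x)).1 = 0 := by
  rw [← hL.apply_eq_zero_iff, ← exp_smul_apply_eq_self_iff]
  refine forall_congr' fun t => ?_
  rw [hL.exp_smul_apply_eq_flow hp]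
  exact ⟨fun h => by rw [h], fun h => congrArg Prod.fst h⟩

end Flow

end IsTangentToGraph

/-- The product of the linear vector field `L` with the expanding field `y' = y` on `H`. -/
def suspension (L : E × F →L[ℝ] E × F) (H : Type*) [NormedAddCommGroup H] [NormedSpace ℝ H] :
    (E × H) × F →L[ℝ] (E × H) × F :=
  let L₁ := L.comp ((ContinuousLinearMap.fst ℝ E H).prodMap (.id ℝ F))
  (((ContinuousLinearMap.fst ℝ E F).comp L₁).prod
    ((ContinuousLinearMap.snd ℝ E H).comp (.fst ℝ (E × H) F))).prod
    ((ContinuousLinearMap.snd ℝ E F).comp L₁)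

variable (H : Type*) [NormedAddCommGroup H] [NormedSpace ℝ H]

theorem IsTangentToGraph.suspension (hL : IsTangentToGraph L p) (hp : Differentiable ℝ p) :
    IsTangentToGraph (SuperLinear.suspension L H) (p ∘ Prod.fst) := by
  intro x
  rw [fderiv_comp x (hp x.1) differentiableAt_fst, fderiv_fst]
  exact hL x.1

theorem encard_zeros_suspension : {x : E × H | (suspension L H (x, p x.1)).1 = 0}.encard =
    {x : E | (L (x, p x)).1 = 0}.encard := by
  have zeros : {x : E × H | (suspension L H (x, p x.1)).1 = 0} =
      (fun x => (x, 0)) '' {x : E | (L (x, p x)).1 = 0} := by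
    ext ⟨x, y⟩
    simp [suspension, Prod.ext_iff, eq_comm]
  rw [zeros, (Prod.mk_left_injective (0 : H)).encard_image]

end InvariantGraph

section Euclidean

variable {k m n : ℕ}

theorem graphMap_eq_symm_finAddEquivProd (p : Euc k → Euc m) (x : Euc k) :
    graphMap p x = EuclideanSpace.finAddEquivProd.symm (x, p x) := by
  rw [ContinuousLinearEquiv.eq_symm_apply]
  ext i <;> simp [graphMap, EuclideanSpace.sumEquivProd]

theorem isSmoothEmb_of_leftInverse {f : Euc k → Euc n} (hf : ContDiff ℝ ∞ f)
    {g : Euc n →L[ℝ] Euc k} (hg : Function.LeftInverse g f) : IsSmoothEmb f where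
  smooth := hf
  embedding := .of_leftInverse hg g.continuous hf.continuous
  injective_fderiv x := by
    have hcomp : g.comp (fderiv ℝ f x) = .id ℝ (Euc k) :=
      (g.hasFDerivAt.comp x (hf.differentiable (by simp) x).hasFDerivAt).unique
        ((hasFDerivAt_id x).congr_of_eventuallyEq (.of_forall hg))
    exact Function.LeftInverse.injective (DFunLike.congr_fun hcomp)

theorem isSmoothEmb_graphMap {p : Euc k → Euc m} (hp : ContDiff ℝ ∞ p) :
    IsSmoothEmb (graphMap p) := by
  refine isSmoothEmb_of_leftInverse (g := (ContinuousLinearMap.fst ℝ (Euc k) (Euc m)).comp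
    EuclideanSpace.finAddEquivProd.toContinuousLinearMap) ?_ ?_
  · rw [funext (graphMap_eq_symm_finAddEquivProd p)]
    exact EuclideanSpace.finAddEquivProd.symm.contDiff.comp (contDiff_id.prodMk hp)
  · intro x
    simp [graphMap_eq_symm_finAddEquivProd]

theorem linearFlow_eq_exp (A : Matrix (Fin n) (Fin n) ℝ) (t : ℝ) (x : Euc n) :
    linearFlow A t x = NormedSpace.exp (t • Matrix.toEuclideanCLM (n := Fin n) (𝕜 := ℝ) A) x := by
  have continuous_toEuclideanCLM : Continuous (Matrix.toEuclideanCLM (n := Fin n) (𝕜 := ℝ)) :=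
    LinearMap.continuous_of_finiteDimensional
      (Matrix.toEuclideanCLM (n := Fin n) (𝕜 := ℝ)).toAlgEquiv.toLinearMap
  open scoped Matrix.Norms.Operator in
  rw [← map_smul, ← NormedSpace.map_exp _ continuous_toEuclideanCLM]
  rfl

theorem linearFlow_conj {V : Type*} [NormedAddCommGroup V] [NormedSpace ℝ V] [CompleteSpace V]
    (e : V ≃L[ℝ] Euc n) (L : V →L[ℝ] V) (t : ℝ) (v : V) :
    linearFlow ((Matrix.toEuclideanCLM (n := Fin n) (𝕜 := ℝ)).symm
      (e.conjContinuousAlgEquiv L)) t (e v) = e (NormedSpace.exp (t • L) v) := by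
  let := NormedAlgebra.restrictScalars ℚ ℝ (V →L[ℝ] V)
  rw [linearFlow_eq_exp, StarAlgEquiv.apply_symm_apply, ← map_smul,
    ← NormedSpace.map_exp _ e.conjContinuousAlgEquiv.continuous]
  simp

/-- The flow `φ` in the coordinates given by the homeomorphism `e`. -/
def conjFlow {τ X Y : Type*} [AddMonoid τ] [TopologicalSpace τ] [ContinuousAdd τ]
    [TopologicalSpace X] [TopologicalSpace Y] (φ : Flow τ X) (e : X ≃ₜ Y) : Flow τ Y where
  toFun t y := e (φ t (e.symm y))
  cont' := e.continuous.comp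
    (φ.cont'.comp (continuous_fst.prodMk (e.symm.continuous.comp continuous_snd)))
  map_add' s t y := by rw [φ.map_add, e.symm_apply_apply]
  map_zero' y := by rw [φ.map_zero_apply, e.apply_symm_apply]

theorem setOf_isEquilibrium_conjFlow {X : Type*} [TopologicalSpace X] (φ : Flow ℝ X)
    (e : X ≃ₜ Euc k) : {x | IsEquilibrium (conjFlow φ e) x} = e '' {x | ∀ t, φ t x = x} := by
  rw [e.image_eq_preimage_symm]
  exact Set.ext fun x => forall_congr' fun t => e.eq_symm_apply.symm

theorem IsTangentToGraph.exists_isSuperLinearizable {E F : Type*}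
    [NormedAddCommGroup E] [NormedSpace ℝ E] [FiniteDimensional ℝ E]
    [NormedAddCommGroup F] [NormedSpace ℝ F] [FiniteDimensional ℝ F]
    {L : E × F →L[ℝ] E × F} {p : E → F} (hL : IsTangentToGraph L p) (hp : ContDiff ℝ ∞ p)
    (hk : Module.finrank ℝ E = k) :
    ∃ Φ : Flow ℝ (Euc k), IsSmoothFlow Φ ∧ IsSuperLinearizable Φ ∧
      {x | IsEquilibrium Φ x}.encard = {x | (L (x, p x)).1 = 0}.encard := by
  have := FiniteDimensional.complete ℝ E
  have := FiniteDimensional.complete ℝ F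
  have hp1 : ContDiff ℝ 1 p := hp.of_le (by simp)
  let e : E ≃L[ℝ] Euc k := .ofFinrankEq (by simpa using hk)
  let f : F ≃L[ℝ] Euc (Module.finrank ℝ F) := .ofFinrankEq (by simp)
  let C : (E × F) ≃L[ℝ] Euc (k + Module.finrank ℝ F) :=
    (e.prodCongr f).trans EuclideanSpace.finAddEquivProd.symm
  have graphMap_apply (y : E) : graphMap (f ∘ p ∘ e.symm) (e y) = C (y, p y) := by
    rw [graphMap_eq_symm_finAddEquivProd]
    simp [C]
  refine ⟨conjFlow (hL.flow hp1) e.toHomeomorph, ?_, ⟨_,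
    (Matrix.toEuclideanCLM (n := Fin _) (𝕜 := ℝ)).symm (C.conjContinuousAlgEquiv L),
    f ∘ p ∘ e.symm, isSmoothEmb_graphMap (f.contDiff.comp (hp.comp e.symm.contDiff)), ?_⟩, ?_⟩
  · exact e.contDiff.comp ((hL.contDiff_flow hp1 hp).comp
      (contDiff_fst.prodMk (e.symm.contDiff.comp contDiff_snd)))
  · intro t x
    obtain ⟨y, rfl⟩ := e.surjective x
    have conjFlow_apply : conjFlow (hL.flow hp1) e.toHomeomorph t (e y) = e (hL.flow hp1 t y) :=
      congrArg (fun y => e (hL.flow hp1 t y)) (e.symm_apply_apply y)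
    rw [graphMap_apply, linearFlow_conj, hL.exp_smul_apply_eq_flow hp1, conjFlow_apply,
      graphMap_apply]
  · rw [setOf_isEquilibrium_conjFlow, e.toHomeomorph.injective.encard_image]
    simp only [hL.flow_eq_self_iff hp1]

theorem isIsolatedEquilibrium_of_finite {Φ : Flow ℝ (Euc k)}
    (h : {x | IsEquilibrium Φ x}.Finite) {x : Euc k} (hx : IsEquilibrium Φ x) :
    IsIsolatedEquilibrium Φ x := by
  refine ⟨hx, ({y | IsEquilibrium Φ y} \ {x})ᶜ,
    (h.subset Set.sdiff_subset).isClosed.isOpen_compl.mem_nhds (by simp), fun y hy hy' => ?_⟩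
  by_contra hne
  exact hy ⟨hy', hne⟩

end Euclidean

section InverseFunction

variable {E F : Type*} [NormedAddCommGroup E] [NormedSpace ℝ E]
  [NormedAddCommGroup F] [NormedSpace ℝ F]

theorem fderiv_apply_fderiv_of_leftInverse {f : E → F} {g : F → E} {x : E}
    (hgf : g ∘ f =ᶠ[𝓝 x] id) (hg : DifferentiableAt ℝ g (f x)) (hf : DifferentiableAt ℝ f x)
    (v : E) : fderiv ℝ g (f x) (fderiv ℝ f x v) = v := by
  have hcomp := (hg.hasFDerivAt.comp x hf.hasFDerivAt).unique
    ((hasFDerivAt_id x).congr_of_eventuallyEq hgf)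
  exact DFunLike.congr_fun hcomp v

theorem contDiff_of_rightInverse [CompleteSpace E] {n : WithTop ℕ∞} (hn : n ≠ 0) {s : Set E}
    (hs : IsOpen s) {f : E → F} (hinj : Set.InjOn f s) (hf : ∀ x ∈ s, ContDiffAt ℝ n f x)
    (hf' : ∀ x ∈ s, (fderiv ℝ f x).IsInvertible) {g : F → E} (hg : ∀ y, g y ∈ s)
    (hfg : Function.RightInverse g f) : ContDiff ℝ n g := by
  refine contDiff_iff_contDiffAt.2 fun y => ?_
  obtain ⟨e, he⟩ := hf' (g y) (hg y)
  have hfe : HasFDerivAt f (e : E →L[ℝ] F) (g y) :=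
    he ▸ ((hf _ (hg y)).differentiableAt hn).hasFDerivAt
  set h := (hf _ (hg y)).localInverse hfe hn
  have hh : ContDiffAt ℝ n h y := by
    simpa only [hfg y] using (hf _ (hg y)).to_localInverse hfe hn
  have hhy : h y = g y := by
    simpa only [hfg y] using (hf _ (hg y)).localInverse_apply_image hfe hn
  have hfh : ∀ᶠ x in 𝓝 (f (g y)), f (h x) = x :=
    ((hf _ (hg y)).hasStrictFDerivAt' hfe hn).eventually_right_inverse
  rw [hfg y] at hfh
  have hhs : ∀ᶠ x in 𝓝 y, h x ∈ s :=
    hh.continuousAt.eventually_mem (hhy ▸ hs.mem_nhds (hg y))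
  refine hh.congr_of_eventuallyEq ?_
  filter_upwards [hfh, hhs] with x hx hxs
  exact hinj (hg x) hxs ((hfg x).trans hx.symm)

end InverseFunction

section Shear

variable {V : ℝ × ℝ → ℝ} {a b : ℝ}

theorem isInvertible_fst_prod {D : ℝ × ℝ →L[ℝ] ℝ} (hD : D (0, 1) ≠ 0) :
    ((ContinuousLinearMap.fst ℝ ℝ ℝ).prod D).IsInvertible := by
  have hinj : Function.Injective ((ContinuousLinearMap.fst ℝ ℝ ℝ).prod D) := by
    refine (injective_iff_map_eq_zero _).2 fun x hx => ?_
    obtain ⟨u, s⟩ := x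
    obtain rfl : u = 0 := congrArg Prod.fst hx
    have hs : s * D (0, 1) = 0 := by
      have hDs : D (0, s) = 0 := congrArg Prod.snd hx
      rwa [← smul_eq_mul, ← map_smul, Prod.smul_mk, smul_zero, smul_eq_mul, mul_one]
    rw [(mul_eq_zero.1 hs).resolve_right hD, Prod.mk_zero_zero]
  exact ⟨(LinearEquiv.ofInjectiveEndo _ hinj).toContinuousLinearEquiv, rfl⟩

theorem bijOn_Ioo_univ_of_hasDerivAt_pos {f f' : ℝ → ℝ} (hab : a < b)
    (hf : ∀ x ∈ Set.Ioo a b, HasDerivAt f (f' x) x) (hf' : ∀ x ∈ Set.Ioo a b, 0 < f' x)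
    (hbot : Filter.Tendsto f (𝓝[>] a) Filter.atBot)
    (htop : Filter.Tendsto f (𝓝[<] b) Filter.atTop) : Set.BijOn f (Set.Ioo a b) Set.univ := by
  have hcont : ContinuousOn f (Set.Ioo a b) := fun x hx =>
    (hf x hx).continuousAt.continuousWithinAt
  have hmono : StrictMonoOn f (Set.Ioo a b) :=
    strictMonoOn_of_deriv_pos (convex_Ioo a b) hcont fun x hx => by
      rw [interior_Ioo] at hx
      exact (hf x hx).deriv ▸ hf' x hx
  exact ⟨Set.mapsTo_univ _ _, hmono.injOn, hcont.surjOn_of_tendsto (Set.nonempty_Ioo.2 hab)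
    ((tendsto_comp_coe_Ioo_atBot hab).2 hbot) ((tendsto_comp_coe_Ioo_atTop hab).2 htop)⟩

theorem exists_contDiff_inverse_shear (hab : a < b)
    (hV : ∀ z : ℝ × ℝ, z.2 ∈ Set.Ioo a b → ContDiffAt ℝ ∞ V z)
    (hV' : ∀ z : ℝ × ℝ, z.2 ∈ Set.Ioo a b → 0 < fderiv ℝ V z (0, 1))
    (hbot : ∀ u, Filter.Tendsto (fun s => V (u, s)) (𝓝[>] a) Filter.atBot)
    (htop : ∀ u, Filter.Tendsto (fun s => V (u, s)) (𝓝[<] b) Filter.atTop) :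
    ∃ G : ℝ × ℝ → ℝ × ℝ, ContDiff ℝ ∞ G ∧ (∀ y, (G y).2 ∈ Set.Ioo a b) ∧
      (∀ y, ((G y).1, V (G y)) = y) ∧ ∀ z : ℝ × ℝ, z.2 ∈ Set.Ioo a b → G (z.1, V z) = z := by
  have hdiff (z : ℝ × ℝ) (hz : z.2 ∈ Set.Ioo a b) : DifferentiableAt ℝ V z :=
    (hV z hz).differentiableAt (by simp)
  have hfiber (u : ℝ) : Set.BijOn (fun s => V (u, s)) (Set.Ioo a b) Set.univ :=
    bijOn_Ioo_univ_of_hasDerivAt_pos hab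
      (fun s hs => (hdiff (u, s) hs).hasFDerivAt.comp_hasDerivAt s
        ((hasDerivAt_const s u).prodMk (hasDerivAt_id s)))
      (fun s hs => hV' (u, s) hs) (hbot u) (htop u)
  have hinj : Set.InjOn (fun z : ℝ × ℝ => (z.1, V z)) {z | z.2 ∈ Set.Ioo a b} := by
    rintro ⟨u, s⟩ hs ⟨u', s'⟩ hs' h
    obtain rfl : u = u' := congrArg Prod.fst h
    exact Prod.ext rfl ((hfiber u).injOn hs hs' (congrArg Prod.snd h))
  choose σ hσ hVσ using fun u v => (hfiber u).surjOn (Set.mem_univ v)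
  have hright (y : ℝ × ℝ) : (y.1, V (y.1, σ y.1 y.2)) = y := Prod.ext rfl (hVσ y.1 y.2)
  refine ⟨fun y => (y.1, σ y.1 y.2), ?_, fun y => hσ y.1 y.2, hright,
    fun z hz => hinj (hσ z.1 (V z)) hz (hright (z.1, V z))⟩
  refine contDiff_of_rightInverse (by simp) (isOpen_Ioo.preimage continuous_snd) hinj
    (fun z hz => contDiffAt_fst.prodMk (hV z hz)) (fun z hz => ?_) (fun y => hσ y.1 y.2) hright
  rw [(hasFDerivAt_fst.prodMk (hdiff z hz).hasFDerivAt).fderiv]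
  exact isInvertible_fst_prod (hV' z hz).ne'

end Shear

section Step

theorem hasDerivAt_expNegInvGlue {x : ℝ} (hx : 0 < x) :
    HasDerivAt expNegInvGlue (expNegInvGlue x / x ^ 2) x := by
  have hexp : expNegInvGlue =ᶠ[𝓝 x] fun x => Real.exp (-x⁻¹) := by
    filter_upwards [lt_mem_nhds hx] with y hy
    rw [expNegInvGlue, if_neg hy.not_ge]
  refine ((hasDerivAt_inv hx.ne').fun_neg.exp.congr_of_eventuallyEq hexp).congr_deriv ?_
  rw [expNegInvGlue, if_neg hx.not_ge]
  ring

theorem expNegInvGlue_lt_expNegInvGlue {x y : ℝ} (hy : 0 < y) (hxy : x < y) :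
    expNegInvGlue x < expNegInvGlue y := by
  rcases le_or_gt x 0 with hx | hx
  · rw [expNegInvGlue.zero_of_nonpos hx]
    exact expNegInvGlue.pos_of_pos hy
  · rw [expNegInvGlue, expNegInvGlue, if_neg hx.not_ge, if_neg hy.not_ge]
    gcongr

/-- A smooth odd monotone step from `-1 / 2` to `1 / 2`, constant outside `[-1 / 2, 1 / 2]`. -/
def step (q : ℝ) : ℝ := Real.smoothTransition (q + 1 / 2) - 1 / 2

theorem contDiff_step : ContDiff ℝ ∞ step :=
  (Real.smoothTransition.contDiff.comp (contDiff_id.add contDiff_const)).sub contDiff_const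

theorem step_eq (q : ℝ) : step q =
    (expNegInvGlue (1 / 2 + q) - expNegInvGlue (1 / 2 - q)) /
      (2 * (expNegInvGlue (1 / 2 + q) + expNegInvGlue (1 / 2 - q))) := by
  have hpos := (Real.smoothTransition.pos_denom (1 / 2 + q)).ne'
  rw [show 1 - (1 / 2 + q) = 1 / 2 - q by ring] at hpos
  rw [step, Real.smoothTransition, add_comm q, show 1 - (1 / 2 + q) = 1 / 2 - q by ring,
    div_sub_div _ _ hpos two_ne_zero, mul_comm 2]
  ring

theorem step_neg (q : ℝ) : step (-q) = -step q := by
  rw [step_eq, step_eq, ← neg_div, neg_sub, sub_neg_eq_add, ← sub_eq_add_neg,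
    add_comm (expNegInvGlue (1 / 2 - q))]

theorem step_of_half_le {q : ℝ} (hq : 1 / 2 ≤ q) : step q = 1 / 2 := by
  rw [step, Real.smoothTransition.one_of_one_le (by linarith)]
  norm_num

theorem monotone_step : Monotone step := fun _ _ h =>
  sub_le_sub_right (Real.smoothTransition.monotone (by linarith)) _

theorem step_pos {q : ℝ} (hq : 0 < q) : 0 < step q := by
  rw [step_eq]
  have hlt : expNegInvGlue (1 / 2 - q) < expNegInvGlue (1 / 2 + q) :=
    expNegInvGlue_lt_expNegInvGlue (by linarith) (by linarith)
  have hnonneg := expNegInvGlue.nonneg (1 / 2 - q)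
  exact div_pos (by linarith) (by linarith)

theorem step_mul_self_pos {q : ℝ} (hq : q ≠ 0) : 0 < step q * q := by
  rcases hq.lt_or_gt with h | h
  · have hneg := step_pos (neg_pos.2 h)
    rw [step_neg] at hneg
    nlinarith
  · exact mul_pos (step_pos h) h

theorem abs_step_le (q : ℝ) : |step q| ≤ 1 / 2 := by
  rw [abs_le, step]
  constructor <;> linarith [Real.smoothTransition.nonneg (q + 1 / 2),
    Real.smoothTransition.le_one (q + 1 / 2)]

theorem hasDerivAt_step (q : ℝ) : HasDerivAt step (deriv step q) q :=
  (contDiff_step.differentiable (by simp) q).hasDerivAt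

theorem deriv_step_nonneg (q : ℝ) : 0 ≤ deriv step q := monotone_step.deriv_nonneg

theorem deriv_step_zero : deriv step 0 = 2 := by
  have hglue : 0 < expNegInvGlue (1 / 2) := expNegInvGlue.pos_of_pos (by norm_num)
  have hplus : HasDerivAt (fun q => expNegInvGlue (1 / 2 + q)) (4 * expNegInvGlue (1 / 2)) 0 := by
    refine (HasDerivAt.comp_const_add (1 / 2) 0
      (hasDerivAt_expNegInvGlue (by norm_num))).congr_deriv ?_
    rw [add_zero]
    ring
  have hminus : HasDerivAt (fun q => expNegInvGlue (1 / 2 - q))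
      (-(4 * expNegInvGlue (1 / 2))) 0 := by
    refine (HasDerivAt.comp_const_sub (1 / 2) 0
      (hasDerivAt_expNegInvGlue (by norm_num))).congr_deriv ?_
    rw [sub_zero]
    ring
  rw [funext step_eq, ((hplus.fun_sub hminus).fun_div ((hplus.fun_add hminus).const_mul 2)
    (by rw [add_zero, sub_zero]; positivity)).deriv]
  rw [add_zero, sub_zero]
  field_simp
  ring

end Step

section Hyperboloid

/-- The radius `√(1 + u²)` of the hyperboloid `w² + q² = 1 + u²` at height `u`. -/
def radius (u : ℝ) : ℝ := √(1 + u ^ 2)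

theorem radius_sq (u : ℝ) : radius u ^ 2 = 1 + u ^ 2 := Real.sq_sqrt (by positivity)

theorem one_le_radius (u : ℝ) : 1 ≤ radius u :=
  Real.one_le_sqrt.2 (le_add_of_nonneg_right (sq_nonneg u))

theorem radius_pos (u : ℝ) : 0 < radius u := one_pos.trans_le (one_le_radius u)

theorem contDiff_radius : ContDiff ℝ ∞ radius :=
  (contDiff_const.add (contDiff_id.pow 2)).sqrt fun u =>
    (add_pos_of_pos_of_nonneg one_pos (sq_nonneg u)).ne'

theorem hasDerivAt_radius (u : ℝ) : HasDerivAt radius (u / radius u) u := by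
  have hsq : HasDerivAt (fun u : ℝ => 1 + u ^ 2) (2 * u) u := by
    simpa using (hasDerivAt_pow 2 u).const_add 1
  refine (hsq.sqrt (by positivity)).congr_deriv ?_
  rw [radius]
  ring

/-- The coordinate `w = √(1 + u²) cos s` on the universal cover of the hyperboloid
`w² + q² = 1 + u²`, which is the plane with coordinates `z = (u, s)`. -/
def cosCoord (z : ℝ × ℝ) : ℝ := radius z.1 * Real.cos z.2

/-- The coordinate `q = √(1 + u²) sin s` on the universal cover of the hyperboloid. -/
def sinCoord (z : ℝ × ℝ) : ℝ := radius z.1 * Real.sin z.2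

/-- The lift to the universal cover of the hyperboloid of the linear vector field `u' = w`,
`w' = u`, `q' = 0`. -/
def boost (z : ℝ × ℝ) : ℝ × ℝ := (cosCoord z, -(z.1 * Real.sin z.2 / radius z.1))

theorem contDiff_cosCoord : ContDiff ℝ ∞ cosCoord :=
  (contDiff_radius.comp contDiff_fst).mul (Real.contDiff_cos.comp contDiff_snd)

theorem contDiff_sinCoord : ContDiff ℝ ∞ sinCoord :=
  (contDiff_radius.comp contDiff_fst).mul (Real.contDiff_sin.comp contDiff_snd)

theorem fderiv_cosCoord (z x : ℝ × ℝ) : fderiv ℝ cosCoord z x =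
    z.1 / radius z.1 * Real.cos z.2 * x.1 - sinCoord z * x.2 := by
  have hsnd : HasFDerivAt (Prod.snd : ℝ × ℝ → ℝ) (.snd ℝ ℝ ℝ) z := hasFDerivAt_snd
  have hmul : HasFDerivAt cosCoord _ z :=
    ((hasDerivAt_radius z.1).comp_hasFDerivAt z hasFDerivAt_fst).mul
      ((Real.hasDerivAt_cos z.2).comp_hasFDerivAt z hsnd)
  rw [hmul.fderiv]
  simp only [Function.comp_apply, neg_smul, smul_neg, add_apply, neg_apply, smul_apply,
    ContinuousLinearMap.coe_snd', smul_eq_mul, ContinuousLinearMap.coe_fst', sinCoord]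
  ring

theorem fderiv_sinCoord (z x : ℝ × ℝ) : fderiv ℝ sinCoord z x =
    z.1 / radius z.1 * Real.sin z.2 * x.1 + cosCoord z * x.2 := by
  have hsnd : HasFDerivAt (Prod.snd : ℝ × ℝ → ℝ) (.snd ℝ ℝ ℝ) z := hasFDerivAt_snd
  have hmul : HasFDerivAt sinCoord _ z :=
    ((hasDerivAt_radius z.1).comp_hasFDerivAt z hasFDerivAt_fst).mul
      ((Real.hasDerivAt_sin z.2).comp_hasFDerivAt z hsnd)
  rw [hmul.fderiv]
  simp only [Function.comp_apply, add_apply, smul_apply, ContinuousLinearMap.coe_snd',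
    smul_eq_mul, ContinuousLinearMap.coe_fst', cosCoord]
  ring

theorem fderiv_cosCoord_boost (z : ℝ × ℝ) : fderiv ℝ cosCoord z (boost z) = z.1 := by
  have hradius := (radius_pos z.1).ne'
  rw [fderiv_cosCoord, boost, cosCoord, sinCoord]
  field_simp
  linear_combination z.1 * Real.sin_sq_add_cos_sq z.2

theorem fderiv_sinCoord_boost (z : ℝ × ℝ) : fderiv ℝ sinCoord z (boost z) = 0 := by
  have hradius := (radius_pos z.1).ne'
  rw [fderiv_sinCoord, boost, cosCoord]
  field_simp
  ring

theorem abs_cosCoord_lt (z : ℝ × ℝ) : |cosCoord z| < 2 + z.1 ^ 2 := by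
  have hle : |cosCoord z| ≤ radius z.1 := by
    rw [cosCoord, abs_mul, abs_of_pos (radius_pos z.1)]
    exact mul_le_of_le_one_right (radius_pos z.1).le (Real.abs_cos_le_one z.2)
  nlinarith [radius_sq z.1, one_le_radius z.1]

theorem cosCoord_ne_zero_of_sinCoord_eq_zero {z : ℝ × ℝ} (h : sinCoord z = 0) :
    cosCoord z ≠ 0 := by
  intro hcos
  have hradius := (radius_pos z.1).ne'
  have hsq := Real.sin_sq_add_cos_sq z.2
  rw [(mul_eq_zero.1 h).resolve_left hradius, (mul_eq_zero.1 hcos).resolve_left hradius] at hsq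
  norm_num at hsq

theorem boost_eq_zero_iff {z : ℝ × ℝ} : boost z = 0 ↔ z.1 = 0 ∧ Real.cos z.2 = 0 := by
  have hradius := (radius_pos z.1).ne'
  simp only [boost, cosCoord, Prod.mk_eq_zero, mul_eq_zero, hradius, false_or, neg_eq_zero,
    div_eq_zero_iff, or_false]
  constructor
  · rintro ⟨hcos, hu | hsin⟩
    · exact ⟨hu, hcos⟩
    · exact absurd (mul_eq_zero_of_right _ hcos)
        (cosCoord_ne_zero_of_sinCoord_eq_zero (mul_eq_zero_of_right _ hsin))
  · exact fun ⟨hu, hcos⟩ => ⟨hcos, .inl hu⟩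

end Hyperboloid

section Staircase

theorem sinCoord_neg (u s : ℝ) : sinCoord (u, -s) = -sinCoord (u, s) := by
  simp [sinCoord]

theorem sinCoord_sub_int_mul_pi (n : ℤ) (u s : ℝ) :
    sinCoord (u, s - n * Real.pi) = (-1) ^ n * sinCoord (u, s) := by
  rw [sinCoord, sinCoord, Real.sin_sub_int_mul_pi]
  ring

theorem half_le_sinCoord {u s : ℝ} (h1 : Real.pi / 6 ≤ s) (h2 : s ≤ 5 * Real.pi / 6) :
    1 / 2 ≤ sinCoord (u, s) := by
  have hsin : 1 / 2 ≤ Real.sin s := by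
    rw [← Real.sin_pi_div_six]
    rcases le_total s (Real.pi / 2) with h | h
    · exact Real.sin_le_sin_of_le_of_le_pi_div_two (by linarith [Real.pi_pos]) h h1
    · rw [← Real.sin_pi_sub s]
      exact Real.sin_le_sin_of_le_of_le_pi_div_two (by linarith [Real.pi_pos]) (by linarith)
        (by linarith)
  exact hsin.trans (le_mul_of_one_le_left (by linarith) (one_le_radius u))

theorem sinCoord_pos {u s : ℝ} (h1 : 0 < s) (h2 : s < Real.pi) : 0 < sinCoord (u, s) :=
  mul_pos (radius_pos u) (Real.sin_pos_of_pos_of_lt_pi h1 h2)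

theorem abs_sub_round_div_pi_mul_pi (s : ℝ) :
    |s - round (s / Real.pi) * Real.pi| ≤ Real.pi / 2 := by
  have hpi := Real.pi_pos
  have hround := mul_le_mul_of_nonneg_right (abs_sub_round (s / Real.pi)) hpi.le
  rwa [← abs_of_pos hpi, ← abs_mul, abs_of_pos hpi, sub_mul, div_mul_cancel₀ _ hpi.ne',
    one_div_mul_eq_div] at hround

theorem step_neg_one_zpow_mul (n : ℤ) (q : ℝ) : step ((-1) ^ n * q) = (-1) ^ n * step q := by
  rcases n.even_or_odd with hn | hn
  · simp [hn.neg_one_zpow]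
  · simp [hn.neg_one_zpow, step_neg]

/-- The first integral `n + (-1) ^ n * step q` on the `n`-th sheet `|s - n π| ≤ π / 2` of the
universal cover of the hyperboloid. Since `|q| ≥ 1 / 2` near the boundary of a sheet, it is locally
constant there and the sheets match. -/
def staircase (z : ℝ × ℝ) : ℝ :=
  round (z.2 / Real.pi) + (-1) ^ round (z.2 / Real.pi) * step (sinCoord z)

theorem staircase_add_int_mul_pi (n : ℤ) (u s : ℝ) :
    staircase (u, s + n * Real.pi) = staircase (u, s) + n := by
  have hround : round ((s + n * Real.pi) / Real.pi) = round (s / Real.pi) + n := by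
    rw [add_div, mul_div_cancel_right₀ _ Real.pi_pos.ne', round_add_intCast]
  have hsin := sinCoord_sub_int_mul_pi n u (s + n * Real.pi)
  rw [add_sub_cancel_right] at hsin
  simp only [staircase, hround]
  rw [zpow_add₀ (by norm_num), mul_assoc, ← step_neg_one_zpow_mul n, ← hsin]
  push_cast
  ring

theorem staircase_of_abs_lt {u s : ℝ} (hs : |s| < 5 * Real.pi / 6) :
    staircase (u, s) = step (sinCoord (u, s)) := by
  have hpi := Real.pi_pos
  obtain ⟨hs1, hs2⟩ := abs_lt.1 hs
  obtain ⟨hr1, hr2⟩ := abs_le.1 (abs_sub_round_div_pi_mul_pi s)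
  have hlower : -2 < round (s / Real.pi) := by
    have : (-2 : ℝ) < round (s / Real.pi) := by nlinarith
    exact_mod_cast this
  have hupper : round (s / Real.pi) < 2 := by
    have : (round (s / Real.pi) : ℝ) < 2 := by nlinarith
    exact_mod_cast this
  rw [staircase]
  dsimp only
  generalize round (s / Real.pi) = n at hr1 hr2 hlower hupper ⊢
  interval_cases n
  · push_cast at hr2
    have hstep : step (-sinCoord (u, s)) = 1 / 2 := by
      rw [← sinCoord_neg]
      exact step_of_half_le (half_le_sinCoord (by linarith) (by linarith))
    rw [step_neg] at hstep
    simp only [Int.reduceNeg, zpow_neg, zpow_one]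
    push_cast
    linarith
  · simp
  · push_cast at hr1
    have hstep : step (sinCoord (u, s)) = 1 / 2 :=
      step_of_half_le (half_le_sinCoord (by linarith) (by linarith))
    rw [hstep]
    norm_num

theorem staircase_of_abs_sub_lt {n : ℤ} {z : ℝ × ℝ} (hz : |z.2 - n * Real.pi| < 5 * Real.pi / 6) :
    staircase z = n + (-1) ^ n * step (sinCoord z) := by
  have hshift := staircase_add_int_mul_pi n z.1 (z.2 - n * Real.pi)
  rw [sub_add_cancel, staircase_of_abs_lt hz, sinCoord_sub_int_mul_pi,
    step_neg_one_zpow_mul] at hshift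
  exact hshift.trans (add_comm _ _)

theorem staircase_eventuallyEq (z : ℝ × ℝ) : staircase =ᶠ[𝓝 z] fun y =>
    round (z.2 / Real.pi) + (-1) ^ round (z.2 / Real.pi) * step (sinCoord y) := by
  have hcont : Continuous fun y : ℝ × ℝ => |y.2 - round (z.2 / Real.pi) * Real.pi| := by fun_prop
  have hlt : |z.2 - round (z.2 / Real.pi) * Real.pi| < 5 * Real.pi / 6 :=
    (abs_sub_round_div_pi_mul_pi z.2).trans_lt (by linarith [Real.pi_pos])
  filter_upwards [hcont.continuousAt.eventually_lt_const hlt] with y hy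
  exact staircase_of_abs_sub_lt hy

theorem contDiff_step_sinCoord : ContDiff ℝ ∞ fun z => step (sinCoord z) :=
  contDiff_step.comp contDiff_sinCoord

theorem contDiff_staircase : ContDiff ℝ ∞ staircase :=
  contDiff_iff_contDiffAt.2 fun z => ContDiffAt.congr_of_eventuallyEq
    (contDiff_const.add (contDiff_const.mul contDiff_step_sinCoord)).contDiffAt
    (staircase_eventuallyEq z)

theorem continuous_staircase_snd (u : ℝ) : Continuous fun s => staircase (u, s) :=
  contDiff_staircase.continuous.comp (Continuous.prodMk_right u)

theorem hasFDerivAt_step_sinCoord (z : ℝ × ℝ) : HasFDerivAt (fun z => step (sinCoord z))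
    (deriv step (sinCoord z) • fderiv ℝ sinCoord z) z :=
  (hasDerivAt_step _).comp_hasFDerivAt z
    (contDiff_sinCoord.differentiable (by simp) z).hasFDerivAt

theorem fderiv_staircase (z x : ℝ × ℝ) : fderiv ℝ staircase z x =
    (-1) ^ round (z.2 / Real.pi) * (deriv step (sinCoord z) * fderiv ℝ sinCoord z x) := by
  rw [(staircase_eventuallyEq z).fderiv_eq,
    (((hasFDerivAt_step_sinCoord z).const_mul _).const_add _).fderiv]
  simp

theorem fderiv_staircase_boost (z : ℝ × ℝ) : fderiv ℝ staircase z (boost z) = 0 := by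
  rw [fderiv_staircase, fderiv_sinCoord_boost, mul_zero, mul_zero]

theorem fderiv_staircase_snd (z : ℝ × ℝ) :
    fderiv ℝ staircase z (0, 1) = deriv step (sinCoord z) * |cosCoord z| := by
  have hsign : (-1) ^ round (z.2 / Real.pi) * cosCoord z = |cosCoord z| := by
    have hcos := Real.cos_nonneg_of_mem_Icc (abs_le.1 (abs_sub_round_div_pi_mul_pi z.2))
    rw [Real.cos_sub_int_mul_pi] at hcos
    rw [cosCoord, mul_left_comm, abs_mul, abs_of_pos (radius_pos z.1), ← abs_of_nonneg hcos,
      abs_mul, abs_zpow, abs_neg, abs_one, one_zpow, one_mul]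
  rw [fderiv_staircase, fderiv_sinCoord, ← hsign]
  ring

theorem staircase_pos {u s : ℝ} (hs : 0 < s) : 0 < staircase (u, s) := by
  have hpi := Real.pi_pos
  rcases lt_or_ge s (5 * Real.pi / 6) with h | h
  · rw [staircase_of_abs_lt (by rwa [abs_of_pos hs])]
    exact step_pos (sinCoord_pos hs (by linarith))
  · have hround : (1 : ℝ) ≤ round (s / Real.pi) := by
      have hnear := (abs_le.1 (abs_sub_round_div_pi_mul_pi s)).2
      have hround0 : (0 : ℝ) < round (s / Real.pi) := by
        by_contra! hneg
        nlinarith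
      exact_mod_cast hround0
    have hstep : |(-1) ^ round (s / Real.pi) * step (sinCoord (u, s))| ≤ 1 / 2 := by
      rw [← step_neg_one_zpow_mul]
      exact abs_step_le _
    rw [staircase]
    linarith [(abs_le.1 hstep).1]

theorem staircase_neg (u s : ℝ) : staircase (u, -s) = -staircase (u, s) := by
  have habs : |-s - (-round (s / Real.pi) : ℤ) * Real.pi| < 5 * Real.pi / 6 := by
    rw [Int.cast_neg, neg_mul, ← neg_sub', abs_neg]
    linarith [abs_sub_round_div_pi_mul_pi s, Real.pi_pos]
  rw [staircase_of_abs_sub_lt habs, sinCoord_neg, step_neg, staircase, Int.cast_neg, zpow_neg,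
    ← inv_zpow, inv_neg_one]
  ring

theorem staircase_zero (u : ℝ) : staircase (u, 0) = 0 := by
  have h := staircase_neg u 0
  rw [neg_zero] at h
  linarith

theorem staircase_int_mul_pi (n : ℤ) (u : ℝ) : staircase (u, n * Real.pi) = n := by
  simpa [staircase_zero] using staircase_add_int_mul_pi n u 0

theorem staircase_int_mul_pi_sub (n : ℤ) (u s : ℝ) :
    staircase (u, n * Real.pi - s) = n - staircase (u, s) := by
  rw [sub_eq_neg_add, staircase_add_int_mul_pi, staircase_neg, neg_add_eq_sub]

theorem staircase_lt {l : ℤ} {u s : ℝ} (hs : s < l * Real.pi) : staircase (u, s) < l := by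
  rw [← sub_pos, ← staircase_int_mul_pi_sub]
  exact staircase_pos (sub_pos.2 hs)

theorem staircase_lt_natCast {l : ℕ} {u s : ℝ} (hs : s < l * Real.pi) : staircase (u, s) < l := by
  simpa using staircase_lt (l := l) (u := u) (s := s) (by simpa using hs)

end Staircase

section Chart

variable {l : ℕ}

/-- The second coordinate of a chart `(u, v)` identifying the strip `0 < s < l π` with the plane.
The first two terms are dictated by the requirement that the derivative of `v` along `boost` be a
linear combination of observables which evolve linearly; the logarithms are constant along
`boost`. -/
def chart (l : ℕ) (z : ℝ × ℝ) : ℝ :=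
  (2 + z.1 ^ 2) * staircase z - step (sinCoord z) * cosCoord z + Real.log (staircase z) -
    Real.log (l - staircase z)

theorem contDiffAt_chart {z : ℝ × ℝ} (hz : z.2 ∈ Set.Ioo 0 (l * Real.pi)) :
    ContDiffAt ℝ ∞ (chart l) z := by
  have hpoly : ContDiff ℝ ∞ fun z : ℝ × ℝ =>
      (2 + z.1 ^ 2) * staircase z - step (sinCoord z) * cosCoord z :=
    ((contDiff_const.add (contDiff_fst.pow 2)).mul contDiff_staircase).sub
      (contDiff_step_sinCoord.mul contDiff_cosCoord)
  exact (hpoly.contDiffAt.add (contDiff_staircase.contDiffAt.log (staircase_pos hz.1).ne')).sub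
    ((contDiff_const.sub contDiff_staircase).contDiffAt.log
      (sub_pos.2 (staircase_lt_natCast hz.2)).ne')

theorem fderiv_chart {z : ℝ × ℝ} (hz : z.2 ∈ Set.Ioo 0 (l * Real.pi)) (x : ℝ × ℝ) :
    fderiv ℝ (chart l) z x =
      2 * z.1 * x.1 * staircase z + (2 + z.1 ^ 2) * fderiv ℝ staircase z x -
        (deriv step (sinCoord z) * fderiv ℝ sinCoord z x * cosCoord z +
          step (sinCoord z) * fderiv ℝ cosCoord z x) +
        fderiv ℝ staircase z x / staircase z + fderiv ℝ staircase z x / (l - staircase z) := by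
  have hfst : HasFDerivAt (Prod.fst : ℝ × ℝ → ℝ) (.fst ℝ ℝ ℝ) z := hasFDerivAt_fst
  have hstair := (contDiff_staircase.differentiable (by simp) z).hasFDerivAt
  have hcos := (contDiff_cosCoord.differentiable (by simp) z).hasFDerivAt
  have hchart : HasFDerivAt (chart l) _ z :=
    (((((hfst.pow 2).const_add 2).mul hstair).sub ((hasFDerivAt_step_sinCoord z).mul hcos)).add
      (hstair.log (staircase_pos hz.1).ne')).sub
      ((hstair.const_sub (l : ℝ)).log (sub_pos.2 (staircase_lt_natCast hz.2)).ne')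
  rw [hchart.fderiv]
  simp only [Nat.add_one_sub_one, pow_one, nsmul_eq_mul, Nat.cast_ofNat, smul_neg,
    sub_neg_eq_add, add_apply, sub_apply, smul_apply, smul_eq_mul, ContinuousLinearMap.coe_fst']
  ring

theorem fderiv_chart_boost {z : ℝ × ℝ} (hz : z.2 ∈ Set.Ioo 0 (l * Real.pi)) :
    fderiv ℝ (chart l) z (boost z) =
      -step (sinCoord z) * z.1 + 2 * (staircase z * (z.1 * cosCoord z)) := by
  rw [fderiv_chart hz, fderiv_staircase_boost, fderiv_sinCoord_boost, fderiv_cosCoord_boost,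
    boost]
  ring

theorem fderiv_chart_snd_pos {z : ℝ × ℝ} (hz : z.2 ∈ Set.Ioo 0 (l * Real.pi)) :
    0 < fderiv ℝ (chart l) z (0, 1) := by
  have hderiv := deriv_step_nonneg (sinCoord z)
  have hgap := sub_pos.2 (abs_cosCoord_lt z)
  have hpos : 0 < deriv step (sinCoord z) * |cosCoord z| * (2 + z.1 ^ 2 - |cosCoord z|) +
      step (sinCoord z) * sinCoord z := by
    rcases eq_or_ne (sinCoord z) 0 with hsin | hsin
    · rw [hsin, deriv_step_zero, mul_zero, add_zero]
      have hcos := abs_pos.2 (cosCoord_ne_zero_of_sinCoord_eq_zero hsin)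
      positivity
    · have hstep := step_mul_self_pos hsin
      positivity
  have hstair : 0 ≤ fderiv ℝ staircase z (0, 1) := by
    rw [fderiv_staircase_snd]
    positivity
  have hlog := div_nonneg hstair (staircase_pos (u := z.1) hz.1).le
  have hlog' := div_nonneg hstair (sub_pos.2 (staircase_lt_natCast (u := z.1) hz.2)).le
  have hmain : fderiv ℝ (chart l) z (0, 1) =
      deriv step (sinCoord z) * |cosCoord z| * (2 + z.1 ^ 2 - |cosCoord z|) +
        step (sinCoord z) * sinCoord z + fderiv ℝ staircase z (0, 1) / staircase z +
        fderiv ℝ staircase z (0, 1) / (l - staircase z) := by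
    rw [fderiv_chart hz, fderiv_staircase_snd, fderiv_sinCoord, fderiv_cosCoord]
    linear_combination deriv step (sinCoord z) * sq_abs (cosCoord z)
  rw [hmain]
  exact add_pos_of_pos_of_nonneg (add_pos_of_pos_of_nonneg hpos hlog) hlog'

theorem continuous_chart_regular_part (u : ℝ) : Continuous fun s : ℝ =>
    (2 + u ^ 2) * staircase (u, s) - step (sinCoord (u, s)) * cosCoord (u, s) :=
  (continuous_const.mul (continuous_staircase_snd u)).sub
    ((contDiff_step_sinCoord.mul contDiff_cosCoord).continuous.comp (Continuous.prodMk_right u))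

theorem tendsto_chart_atBot (hl : l ≠ 0) (u : ℝ) :
    Filter.Tendsto (fun s => chart l (u, s)) (𝓝[>] 0) Filter.atBot := by
  have hstair := (continuous_staircase_snd u).tendsto 0
  rw [staircase_zero] at hstair
  have hlog : Filter.Tendsto (fun s => Real.log (staircase (u, s))) (𝓝[>] 0) Filter.atBot :=
    Real.tendsto_log_nhdsGT_zero.comp (tendsto_nhdsWithin_iff.2
      ⟨hstair.mono_left nhdsWithin_le_nhds,
        Filter.eventually_of_mem self_mem_nhdsWithin fun s hs => staircase_pos hs⟩)
  have hregular := ((continuous_chart_regular_part u).tendsto 0).sub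
    ((hstair.const_sub (l : ℝ)).log (by simpa using hl))
  refine ((hregular.mono_left nhdsWithin_le_nhds).add_atBot hlog).congr fun s => ?_
  rw [chart]
  ring

theorem tendsto_chart_atTop (hl : l ≠ 0) (u : ℝ) :
    Filter.Tendsto (fun s => chart l (u, s)) (𝓝[<] (l * Real.pi)) Filter.atTop := by
  have hstair := (continuous_staircase_snd u).tendsto (l * Real.pi)
  rw [show staircase (u, l * Real.pi) = l by simpa using staircase_int_mul_pi l u] at hstair
  have hgap := hstair.const_sub (l : ℝ)
  rw [sub_self] at hgap
  have hlog : Filter.Tendsto (fun s => Real.log (l - staircase (u, s))) (𝓝[<] (l * Real.pi))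
      Filter.atBot :=
    Real.tendsto_log_nhdsGT_zero.comp (tendsto_nhdsWithin_iff.2
      ⟨hgap.mono_left nhdsWithin_le_nhds, Filter.eventually_of_mem self_mem_nhdsWithin
        fun s hs => sub_pos.2 (staircase_lt_natCast hs)⟩)
  have hregular := ((continuous_chart_regular_part u).tendsto (l * Real.pi)).add
    (hstair.log (by simpa using hl))
  exact (hregular.mono_left nhdsWithin_le_nhds).add_atTop (Filter.tendsto_neg_atBot_atTop.comp hlog)

theorem exists_chart_inverse (hl : l ≠ 0) : ∃ G : ℝ × ℝ → ℝ × ℝ, ContDiff ℝ ∞ G ∧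
    Function.Injective G ∧ Set.range G = {z | z.2 ∈ Set.Ioo 0 (l * Real.pi)} ∧
    (∀ y, (G y).1 = y.1) ∧
    ∀ y, fderiv ℝ G y (cosCoord (G y), -step (sinCoord (G y)) * (G y).1 +
      2 * (staircase (G y) * ((G y).1 * cosCoord (G y)))) = boost (G y) := by
  obtain ⟨G, hG, hmem, hright, hleft⟩ := exists_contDiff_inverse_shear (V := chart l)
    (by positivity) (fun _ => contDiffAt_chart) (fun _ => fderiv_chart_snd_pos)
    (tendsto_chart_atBot hl) (tendsto_chart_atTop hl)
  let f (z : ℝ × ℝ) : ℝ × ℝ := (z.1, chart l z)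
  have hf : Function.LeftInverse f G := hright
  refine ⟨G, hG, hf.injective, ?_, fun y => (Prod.ext_iff.1 (hright y)).1, fun y => ?_⟩
  · exact Set.Subset.antisymm (Set.range_subset_iff.2 hmem) fun z hz => ⟨_, hleft z hz⟩
  · have hchart := ((contDiffAt_chart (hmem y)).differentiableAt (by simp)).hasFDerivAt
    have hshear := hasFDerivAt_fst.prodMk hchart
    have hleft_near : G ∘ f =ᶠ[𝓝 (G y)] id := Filter.eventuallyEq_of_mem
      ((isOpen_Ioo.preimage continuous_snd).mem_nhds (hmem y)) hleft
    have hinv := fderiv_apply_fderiv_of_leftInverse hleft_near (hG.differentiable (by simp) _)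
      hshear.differentiableAt (boost (G y))
    rw [hf, hshear.fderiv, ContinuousLinearMap.prod_apply, fderiv_chart_boost (hmem y)] at hinv
    exact hinv

end Chart

section PlanarSystem

/-- The observables which, together with the planar coordinates `(u, v)`, evolve linearly. -/
def observables (z : ℝ × ℝ) : Fin 5 → ℝ :=
  ![cosCoord z, -step (sinCoord z) * z.1, -step (sinCoord z) * cosCoord z,
    staircase z * (z.1 * cosCoord z), staircase z * (z.1 ^ 2 + cosCoord z ^ 2)]

/-- The linear vector field governing the planar coordinates `(u, v)` and the observables `r`. -/
def planarField : (ℝ × ℝ) × (Fin 5 → ℝ) →L[ℝ] (ℝ × ℝ) × (Fin 5 → ℝ) :=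
  LinearMap.toContinuousLinearMap
    { toFun := fun x => ((x.2 0, x.2 1 + 2 * x.2 3), ![x.1.1, x.2 2, x.2 1, x.2 4, 4 * x.2 3])
      map_add' := fun x y => by
        ext i
        · simp
        · simp only [Prod.snd_add, Pi.add_apply, Prod.mk_add_mk]
          ring
        · fin_cases i <;> simp [mul_add]
      map_smul' := fun c x => by
        ext i
        · simp
        · simp only [Prod.smul_snd, Pi.smul_apply, smul_eq_mul, Real.ringHom_apply, Prod.smul_mk]
          ring
        · fin_cases i <;> simp [mul_left_comm] }

theorem planarField_apply (x : (ℝ × ℝ) × (Fin 5 → ℝ)) : planarField x =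
    ((x.2 0, x.2 1 + 2 * x.2 3), ![x.1.1, x.2 2, x.2 1, x.2 4, 4 * x.2 3]) := rfl

theorem contDiff_observables : ContDiff ℝ ∞ observables := by
  have hstep := contDiff_step_sinCoord.neg
  have hcos := contDiff_cosCoord
  have hstair := contDiff_staircase
  refine contDiff_pi.2 fun i => ?_
  fin_cases i
  · exact hcos
  · exact hstep.mul contDiff_fst
  · exact hstep.mul hcos
  · exact hstair.mul (contDiff_fst.mul hcos)
  · exact hstair.mul ((contDiff_fst.pow 2).add (hcos.pow 2))

theorem fderiv_observables_boost (z : ℝ × ℝ) : fderiv ℝ observables z (boost z) =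
    ![z.1, observables z 2, observables z 1, observables z 4, 4 * observables z 3] := by
  have hfst : HasFDerivAt (Prod.fst : ℝ × ℝ → ℝ) (.fst ℝ ℝ ℝ) z := hasFDerivAt_fst
  have hcos := (contDiff_cosCoord.differentiable (by simp) z).hasFDerivAt
  have hstair := (contDiff_staircase.differentiable (by simp) z).hasFDerivAt
  have hstep := (hasFDerivAt_step_sinCoord z).fun_neg
  have hfst_boost : (boost z).1 = cosCoord z := rfl
  have hobs := hasFDerivAt_pi'.1 (contDiff_observables.differentiable (by simp) z).hasFDerivAt
  ext i
  have key (φ' : ℝ × ℝ →L[ℝ] ℝ) (hφ : HasFDerivAt (fun z => observables z i) φ' z) :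
    fderiv ℝ observables z (boost z) i = φ' (boost z) := DFunLike.congr_fun ((hobs i).unique hφ) _
  fin_cases i
  · exact (key _ hcos).trans (fderiv_cosCoord_boost z)
  · refine (key _ (hstep.mul hfst)).trans ?_
    simp [observables, fderiv_sinCoord_boost, hfst_boost]
  · refine (key _ (hstep.mul hcos)).trans ?_
    simp [observables, fderiv_sinCoord_boost, fderiv_cosCoord_boost]
  · refine (key _ (hstair.mul (hfst.mul hcos))).trans
      (?_ : _ = staircase z * (z.1 ^ 2 + cosCoord z ^ 2))
    simp only [smul_add, add_apply, smul_apply, smul_eq_mul, ContinuousLinearMap.coe_fst',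
      hfst_boost, fderiv_cosCoord_boost, fderiv_staircase_boost, mul_zero, add_zero]
    ring
  · refine (key _ (hstair.mul ((hfst.pow 2).add (hcos.pow 2)))).trans
      (?_ : _ = 4 * (staircase z * (z.1 * cosCoord z)))
    simp only [Nat.add_one_sub_one, pow_one, nsmul_eq_mul, Nat.cast_ofNat, smul_add, add_apply,
      smul_apply, smul_eq_mul, ContinuousLinearMap.coe_fst', hfst_boost, fderiv_cosCoord_boost,
      fderiv_staircase_boost, mul_zero, add_zero]
    ring

theorem cos_eq_zero_iff_of_mem_Ioo {l : ℕ} {s : ℝ} (hs : s ∈ Set.Ioo 0 (l * Real.pi)) :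
    Real.cos s = 0 ↔ ∃ j : Fin l, Real.pi / 2 + j * Real.pi = s := by
  rw [Real.cos_eq_zero_iff]
  constructor
  · rintro ⟨k, rfl⟩
    have hlower : 0 < (2 * k + 1 : ℝ) := by
      refine pos_of_mul_pos_left (b := Real.pi) ?_ Real.pi_pos.le
      linarith [hs.1]
    have hupper : (2 * k + 1 : ℝ) < 2 * l := by
      refine lt_of_mul_lt_mul_right (a := Real.pi) ?_ Real.pi_pos.le
      linarith [hs.2]
    norm_cast at hlower hupper
    lift k to ℕ using by lia
    exact ⟨⟨k, by lia⟩, by push_cast; ring⟩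
  · rintro ⟨j, rfl⟩
    exact ⟨j, by push_cast; ring⟩

end PlanarSystem

section Existence

theorem encard_zeros_boost (l : ℕ) :
    {z : ℝ × ℝ | z.2 ∈ Set.Ioo 0 (l * Real.pi) ∧ boost z = 0}.encard = l := by
  have mem_strip (j : Fin l) : Real.pi / 2 + j * Real.pi ∈ Set.Ioo 0 (l * Real.pi) := by
    have hj : (j + 1 : ℝ) ≤ l := by exact_mod_cast j.2
    exact ⟨by positivity, by nlinarith [Real.pi_pos]⟩
  have zeros : {z : ℝ × ℝ | z.2 ∈ Set.Ioo 0 (l * Real.pi) ∧ boost z = 0} =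
      Set.range fun j : Fin l => ((0 : ℝ), Real.pi / 2 + j * Real.pi) := by
    ext ⟨u, s⟩
    constructor
    · rintro ⟨hs, hboost⟩
      obtain ⟨hu, hcos⟩ := boost_eq_zero_iff.1 hboost
      obtain ⟨j, hj⟩ := (cos_eq_zero_iff_of_mem_Ioo hs).1 hcos
      exact ⟨j, Prod.ext hu.symm hj⟩
    · rintro ⟨j, hj⟩
      obtain ⟨rfl, rfl⟩ := Prod.ext_iff.1 hj
      exact ⟨mem_strip j,
        boost_eq_zero_iff.2 ⟨rfl, (cos_eq_zero_iff_of_mem_Ioo (mem_strip j)).2 ⟨j, rfl⟩⟩⟩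
  have hinj : Function.Injective fun j : Fin l => ((0 : ℝ), Real.pi / 2 + j * Real.pi) := by
    intro i j hij
    simpa [Real.pi_ne_zero, Fin.ext_iff] using hij
  rw [zeros, ← Set.image_univ, hinj.encard_image, Set.encard_univ]
  simp

theorem exists_isTangentToGraph_planarField {l : ℕ} (hl : l ≠ 0) :
    ∃ p : ℝ × ℝ → Fin 5 → ℝ, ContDiff ℝ ∞ p ∧ IsTangentToGraph planarField p ∧
      {y | (planarField (y, p y)).1 = 0}.encard = l := by
  obtain ⟨G, hG, hinj, hrange, hfst, hboost⟩ := exists_chart_inverse hl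
  have hfield (y : ℝ × ℝ) : fderiv ℝ G y (planarField (y, observables (G y))).1 = boost (G y) :=
    hboost y
  refine ⟨observables ∘ G, contDiff_observables.comp hG, fun y => ?_, ?_⟩
  · rw [fderiv_comp y (contDiff_observables.differentiable (by simp) _)
      (hG.differentiable (by simp) _), ContinuousLinearMap.comp_apply, Function.comp_apply,
      hfield, fderiv_observables_boost, hfst]
    rfl
  · have zeros : {y | (planarField (y, (observables ∘ G) y)).1 = 0} = G ⁻¹' {z | boost z = 0} := by
      ext y
      refine ⟨fun hy => ?_, fun hy => ?_⟩
      · exact (hfield y).symm.trans ((congrArg _ hy).trans (map_zero _))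
      · obtain ⟨hu, hcos⟩ := boost_eq_zero_iff.1 hy
        simp [planarField_apply, observables, cosCoord, hu, hcos]
    rw [zeros, ← hinj.encard_image, Set.image_preimage_eq_range_inter, hrange]
    exact encard_zeros_boost l

theorem exists_isSuperLinearizable_of_ne_zero {k l : ℕ} (hk : 1 < k) (hl : l ≠ 0) :
    ∃ Φ : Flow ℝ (Euc k), IsSmoothFlow Φ ∧ IsSuperLinearizable Φ ∧
      {x | IsEquilibrium Φ x}.encard = l := by
  obtain ⟨p, hp, hL, hzeros⟩ := exists_isTangentToGraph_planarField hl
  rw [← hzeros, ← encard_zeros_suspension (Euc (k - 2))]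
  refine (hL.suspension (Euc (k - 2)) (hp.differentiable (by simp))).exists_isSuperLinearizable
    (hp.comp contDiff_fst) ?_
  rw [Module.finrank_prod, Module.finrank_prod, Module.finrank_self, finrank_euclideanSpace_fin]
  lia

theorem exists_isSuperLinearizable_zero {k : ℕ} (hk : k ≠ 0) :
    ∃ Φ : Flow ℝ (Euc k), IsSmoothFlow Φ ∧ IsSuperLinearizable Φ ∧
      {x | IsEquilibrium Φ x}.encard = 0 := by
  have : NeZero k := ⟨hk⟩
  obtain ⟨v, hv⟩ := exists_ne (0 : Euc k)
  let L : Euc k × ℝ →L[ℝ] Euc k × ℝ :=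
    ((ContinuousLinearMap.snd ℝ (Euc k) ℝ).smulRight v).prod 0
  have hL : IsTangentToGraph L fun _ => 1 := fun x => by simp [L]
  obtain ⟨Φ, hsmooth, hlin, hzeros⟩ := hL.exists_isSuperLinearizable contDiff_const
    finrank_euclideanSpace_fin
  refine ⟨Φ, hsmooth, hlin, hzeros.trans ?_⟩
  simp [L, hv]

end Existence

end SuperLinear

end

theorem theorem1 (k : ℕ) (hk : 1 < k) (l : ℕ) :
    ∃ Φ : Flow ℝ (SuperLinear.Euc k),
      SuperLinear.IsSmoothFlow Φ ∧
      {x | SuperLinear.IsEquilibrium Φ x}.encard = l ∧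
      (∀ x, SuperLinear.IsEquilibrium Φ x → SuperLinear.IsIsolatedEquilibrium Φ x) ∧
      SuperLinear.IsSuperLinearizable Φ := by
  obtain ⟨Φ, hsmooth, hlin, hcard⟩ : ∃ Φ : Flow ℝ (SuperLinear.Euc k),
      SuperLinear.IsSmoothFlow Φ ∧ SuperLinear.IsSuperLinearizable Φ ∧
      {x | SuperLinear.IsEquilibrium Φ x}.encard = l := by
    rcases eq_or_ne l 0 with rfl | hl
    · exact SuperLinear.exists_isSuperLinearizable_zero (by lia)
    · exact SuperLinear.exists_isSuperLinearizable_of_ne_zero hk hl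
  exact ⟨Φ, hsmooth, hcard, fun _ => SuperLinear.isIsolatedEquilibrium_of_finite
    (Set.finite_of_encard_eq_coe hcard), hlin⟩
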